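/- Let $\mathbf{No}$ be the ordered field of surreal numbers. A surreal number is a function $x\colon\ell(x)\to\{+,-\}$ whose domain $\ell(x)$ is an ordinal; numbers are ordered lexicographically, with $-<\text{undefined}<+$. Write $y\preceq x$ ($y$ is simpler than or equal to $x$) if $y$ is the restriction of $x$ to an ordinal $\le\ell(x)$. For sets $L,R\subseteq\mathbf{No}$ with $L<R$ (that is, $l<r$ for all $l\in L$, $r\in R$), let $\{L\mid R\}$ be the simplest surreal number $x$ with $L<x<R$, that is, the unique such $x$ with $x\preceq y$ for every $y$ with $L<y<R$. Addition and multiplication on $\mathbf{No}$ are Conway's. A class $S\subseteq\mathbf{No}$ is called initial if $x\in S$ and $y\preceq x$ imply $y\in S$. Let $K$ be a subring (with $1$; possibly a proper class) of $\mathbf{No}$ that is initial. Let $L,R\subseteq K$ be sets with $L<R$ (either may be empty), and let $c=\{L\mid R\}$. Then $K[c]$, the subring of $\mathbf{No}$ generated by $K\cup\{c\}$, is initial. -/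

import Mathlib

universe u

/-- A surreal number: a sequence of signs indexed by an ordinal, its length. The sequence is
extended by the value `0` (undefined) at all ordinals from the length on. -/
structure Surreal : Type (u + 1) where
  length : Ordinal.{u}
  sign : Ordinal.{u} → SignType
  sign_eq_zero_iff : ∀ a, sign a = 0 ↔ length ≤ a

namespace Surreal

noncomputable section

open Classical Set

/-- The order: `x < y` if at the first place where they differ
`x` is `-` and `y` undefined or `+`, or `x` is undefined and `y` is `+`. -/
instance : LT Surreal.{u} where
  lt x y := ∃ c, (∀ b < c, x.sign b = y.sign b) ∧ x.sign c < y.sign c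

/-- `x` is simpler than or equal to `y`: `x` is a restriction of `y` to an initial segment. -/
def Simpler (x y : Surreal.{u}) : Prop :=
  x.length ≤ y.length ∧ ∀ b < x.length, x.sign b = y.sign b

/-- `x` is strictly simpler than `y`: the restriction of `y` to an ordinal below its length. -/
def StrictlySimpler (x y : Surreal.{u}) : Prop :=
  x.length < y.length ∧ ∀ b < x.length, x.sign b = y.sign b

/-- A class of surreal numbers is initial if it is closed under simpler numbers. -/
def IsInitial (S : Set Surreal.{u}) : Prop :=
  ∀ x ∈ S, ∀ y, Simpler y x → y ∈ S

instance : Zero Surreal.{u} where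
  zero := ⟨0, fun _ => 0, by simp⟩

instance : One Surreal.{u} where
  one := ⟨1, fun a => if a < 1 then 1 else 0, fun a => by
    rw [← not_lt]; by_cases h : a < 1 <;> simp only [h, if_true, if_false] <;> decide⟩

/-- The class of the surreal numbers `x` with `L < x < R`. -/
def between (L R : Set Surreal.{u}) : Set Surreal.{u} :=
  {x | (∀ l ∈ L, l < x) ∧ ∀ r ∈ R, x < r}

/-- `x` is the simplest element between `L` and `R`. -/
def IsCut (L R : Set Surreal.{u}) (x : Surreal.{u}) : Prop :=
  x ∈ between L R ∧ ∀ y ∈ between L R, Simpler x y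

/-- The number `{L | R}`, the simplest element between `L` and `R`. It exists for all sets `L < R`
(see `isCut_cut`); the value is `0` when there is no such element. -/
def cut (L R : Set Surreal.{u}) : Surreal.{u} :=
  if h : ∃ x, IsCut L R x then h.choose else 0

/-- The canonical left options of `x`. -/
def leftOpts (x : Surreal.{u}) : Set Surreal.{u} := {y | y < x ∧ StrictlySimpler y x}

/-- The canonical right options of `x`. -/
def rightOpts (x : Surreal.{u}) : Set Surreal.{u} := {y | x < y ∧ StrictlySimpler y x}

/-- `x + y = {xᴸ + y, x + yᴸ | xᴿ + y, x + yᴿ}`. -/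
def add (x y : Surreal.{u}) : Surreal.{u} :=
  cut (range (fun a : leftOpts x => add a.1 y) ∪ range (fun b : leftOpts y => add x b.1))
    (range (fun a : rightOpts x => add a.1 y) ∪ range (fun b : rightOpts y => add x b.1))
termination_by (x.length, y.length)
decreasing_by
  · exact Prod.Lex.left _ _ a.2.2.1
  · exact Prod.Lex.right _ b.2.2.1
  · exact Prod.Lex.left _ _ a.2.2.1
  · exact Prod.Lex.right _ b.2.2.1

instance : Add Surreal.{u} where
  add := add

/-- `-x` has the opposite signs. -/
instance : Neg Surreal.{u} where
  neg x := ⟨x.length, fun a => -x.sign a, fun a => by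
    rw [← x.sign_eq_zero_iff]; cases x.sign a <;> decide⟩

instance : Sub Surreal.{u} where
  sub x y := x + -y

/-- `x y = {xᴸ y + x yᴸ - xᴸ yᴸ, xᴿ y + x yᴿ - xᴿ yᴿ | xᴸ y + x yᴿ - xᴸ yᴿ, xᴿ y + x yᴸ - xᴿ yᴸ}`. -/
def mul (x y : Surreal.{u}) : Surreal.{u} :=
  cut
    (range (fun p : leftOpts x × leftOpts y => mul p.1.1 y + mul x p.2.1 - mul p.1.1 p.2.1) ∪
      range (fun p : rightOpts x × rightOpts y => mul p.1.1 y + mul x p.2.1 - mul p.1.1 p.2.1))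
    (range (fun p : leftOpts x × rightOpts y => mul p.1.1 y + mul x p.2.1 - mul p.1.1 p.2.1) ∪
      range (fun p : rightOpts x × leftOpts y => mul p.1.1 y + mul x p.2.1 - mul p.1.1 p.2.1))
termination_by (x.length, y.length)
decreasing_by
  all_goals first
    | exact Prod.Lex.left _ _ p.1.2.2.1
    | exact Prod.Lex.right _ p.2.2.2.1

instance : Mul Surreal.{u} where
  mul := mul

/-! ### The order and the simplest element of a cut -/

theorem ext_sign {x y : Surreal.{u}} (h : ∀ a, x.sign a = y.sign a) : x = y := by
  have hl : x.length = y.length := by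
    apply le_antisymm
    · rw [← x.sign_eq_zero_iff, h, y.sign_eq_zero_iff]
    · rw [← y.sign_eq_zero_iff, ← h, x.sign_eq_zero_iff]
  obtain ⟨l, s, hs⟩ := x
  obtain ⟨l', s', hs'⟩ := y
  obtain rfl : s = s' := funext h
  obtain rfl : l = l' := hl
  rfl

theorem exists_first_diff {x y : Surreal.{u}} (h : x ≠ y) :
    ∃ c, (∀ b < c, x.sign b = y.sign b) ∧ x.sign c ≠ y.sign c := by
  have h' : ∃ a, x.sign a ≠ y.sign a := by
    by_contra! hc
    exact h (ext_sign hc)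
  obtain ⟨c, hc, hm⟩ := WellFounded.has_min (wellFounded_lt (α := Ordinal.{u}))
    {a | x.sign a ≠ y.sign a} h'
  exact ⟨c, fun b hb => by_contra fun hn => hm b hn hb, hc⟩

instance : IsStrictTotalOrder Surreal.{u} (· < ·) where
  irrefl x := fun ⟨c, _, hc⟩ => lt_irrefl _ hc
  trans x y z := by
    rintro ⟨c, hc, hc'⟩ ⟨d, hd, hd'⟩
    rcases lt_trichotomy c d with h | rfl | h
    · exact ⟨c, fun b hb => (hc b hb).trans (hd b (hb.trans h)), hd c h ▸ hc'⟩
    · exact ⟨c, fun b hb => (hc b hb).trans (hd b hb), hc'.trans hd'⟩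
    · exact ⟨d, fun b hb => (hc b (hb.trans h)).trans (hd b hb), (hc d h).symm ▸ hd'⟩
  trichotomous x y hxy hyx := by
    by_contra hne
    obtain ⟨c, hc, hc'⟩ := exists_first_diff hne
    rcases lt_or_gt_of_ne hc' with h | h
    · exact hxy ⟨c, hc, h⟩
    · exact hyx ⟨c, fun b hb => (hc b hb).symm, h⟩

instance : LinearOrder Surreal.{u} := linearOrderOfSTO (· < ·)

theorem lt_def {x y : Surreal.{u}} :
    x < y ↔ ∃ c, (∀ b < c, x.sign b = y.sign b) ∧ x.sign c < y.sign c := Iff.rfl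

theorem Simpler.refl (x : Surreal.{u}) : Simpler x x := ⟨le_rfl, fun _ _ => rfl⟩

theorem Simpler.antisymm {x y : Surreal.{u}} (h : Simpler x y) (h' : Simpler y x) : x = y := by
  have hl := le_antisymm h.1 h'.1
  refine ext_sign fun a => ?_
  by_cases ha : a < x.length
  · exact h.2 a ha
  · rw [(x.sign_eq_zero_iff a).2 (not_lt.1 ha), (y.sign_eq_zero_iff a).2 (hl ▸ not_lt.1 ha)]

theorem StrictlySimpler.ne {x y : Surreal.{u}} (h : StrictlySimpler x y) : x ≠ y := by
  rintro rfl
  exact lt_irrefl _ h.1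

theorem Simpler.not_strictlySimpler {x y : Surreal.{u}} (h : Simpler x y) :
    ¬ StrictlySimpler y x := fun h' => not_lt_of_ge h.1 h'.1

theorem Simpler.strictlySimpler {x y : Surreal.{u}} (h : Simpler x y) (hne : x ≠ y) :
    StrictlySimpler x y := by
  refine ⟨lt_of_le_of_ne h.1 fun hl => hne ?_, h.2⟩
  exact h.antisymm ⟨hl.ge, fun b hb => (h.2 b (hl ▸ hb)).symm⟩

/-- The restriction of `x` to an ordinal `a` below its length. -/
def restrict (x : Surreal.{u}) (a : Ordinal.{u}) (h : a < x.length) : Surreal.{u} where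
  length := a
  sign b := if b < a then x.sign b else 0
  sign_eq_zero_iff b := by
    by_cases hb : b < a
    · simp only [hb, if_true, x.sign_eq_zero_iff]
      exact ⟨fun h' => absurd h (not_lt.2 (h'.trans hb.le)), fun h' => absurd hb (not_lt.2 h')⟩
    · simp [hb, not_lt.1 hb]

theorem exists_of_not_simpler {x y : Surreal.{u}} (h : ¬ Simpler x y) :
    ∃ p, StrictlySimpler p x ∧ Simpler p y ∧ ((p < x ∧ y ≤ p) ∨ (x < p ∧ p ≤ y)) := by
  have hne : x ≠ y := by
    rintro rfl
    exact h (Simpler.refl x)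
  obtain ⟨c, hc, hd⟩ := exists_first_diff hne
  have hcx : c < x.length := by
    by_contra hn
    rw [not_lt] at hn
    refine h ⟨?_, fun b hb => hc b (hb.trans_le hn)⟩
    by_contra hlt
    rw [not_le] at hlt
    have h1 := hc y.length (hlt.trans_le hn)
    rw [(y.sign_eq_zero_iff _).2 le_rfl, x.sign_eq_zero_iff] at h1
    exact not_lt_of_ge h1 hlt
  have hcy : c ≤ y.length := by
    by_contra hlt
    rw [not_le] at hlt
    have h1 := hc y.length hlt
    rw [(y.sign_eq_zero_iff _).2 le_rfl, x.sign_eq_zero_iff] at h1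
    exact not_lt_of_ge h1 (hlt.trans hcx)
  have hpx : ∀ b < c, (x.restrict c hcx).sign b = x.sign b := fun b hb => by simp [restrict, hb]
  have hpc : (x.restrict c hcx).sign c = 0 := by simp [restrict]
  have hxc : x.sign c ≠ 0 := by
    rw [Ne, x.sign_eq_zero_iff]
    exact not_le.2 hcx
  have hpy : ∀ b < c, (x.restrict c hcx).sign b = y.sign b :=
    fun b hb => (hpx b hb).trans (hc b hb)
  have hps : Simpler (x.restrict c hcx) y := ⟨hcy, hpy⟩
  have key : y.sign c = 0 → x.restrict c hcx = y := fun h0 =>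
    hps.antisymm ⟨(y.sign_eq_zero_iff c).1 h0,
      fun b hb => (hpy b (hb.trans_le ((y.sign_eq_zero_iff c).1 h0))).symm⟩
  refine ⟨x.restrict c hcx, ⟨hcx, hpx⟩, hps, ?_⟩
  rcases lt_or_gt_of_ne hxc with hneg | hpos
  · right
    refine ⟨⟨c, fun b hb => (hpx b hb).symm, hpc.symm ▸ hneg⟩, ?_⟩
    by_cases h0 : y.sign c = 0
    · exact (key h0).le
    · refine le_of_lt ⟨c, hpy, hpc.symm ▸ ?_⟩
      revert hneg hd h0
      cases x.sign c <;> cases y.sign c <;> decide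
  · left
    refine ⟨⟨c, hpx, hpc.symm ▸ hpos⟩, ?_⟩
    by_cases h0 : y.sign c = 0
    · exact (key h0).ge
    · refine le_of_lt ⟨c, fun b hb => (hpy b hb).symm, hpc.symm ▸ ?_⟩
      revert hpos hd h0
      cases x.sign c <;> cases y.sign c <;> decide

theorem lt_cases {x y : Surreal.{u}} (h : x < y) : StrictlySimpler x y ∨ StrictlySimpler y x ∨
    ∃ m, StrictlySimpler m x ∧ StrictlySimpler m y ∧ x < m ∧ m < y := by
  by_cases h1 : Simpler x y
  · exact .inl (h1.strictlySimpler h.ne)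
  obtain ⟨p, hpx, hpy, ⟨h2, h3⟩ | ⟨h2, h3⟩⟩ := exists_of_not_simpler h1
  · exact absurd (h3.trans_lt h2) h.asymm
  · right
    by_cases hp : p = y
    · exact .inl (hp ▸ hpx)
    · exact .inr ⟨p, hpx, hpy.strictlySimpler hp, h2, lt_of_le_of_ne h3 hp⟩

/-- The signs of `{L | R}`, up to the first zero. -/
def cutSign (L R : Set Surreal.{u}) (a : Ordinal.{u}) : SignType :=
  if ∃ l ∈ L, (∀ b, (_ : b < a) → l.sign b = cutSign L R b) ∧ 0 ≤ l.sign a then 1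
  else if ∃ r ∈ R, (∀ b, (_ : b < a) → r.sign b = cutSign L R b) ∧ r.sign a ≤ 0 then -1
  else 0
termination_by a

theorem exists_cutSign_eq_zero (L R : Set Surreal.{u}) [Small.{u} L] [Small.{u} R] :
    ∃ a, cutSign L R a = 0 := by
  by_contra! hne
  obtain ⟨m, hm⟩ := Ordinal.bddAbove_of_small (s := length '' (L ∪ R))
  have key : ∀ x ∈ L ∪ R, ¬ ∀ b < Order.succ m, x.sign b = cutSign L R b := by
    intro x hx h
    have h1 : x.length < Order.succ m := Order.lt_succ_of_le (hm ⟨x, hx, rfl⟩)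
    have h2 := h _ h1
    rw [(x.sign_eq_zero_iff _).2 le_rfl] at h2
    exact hne _ h2.symm
  have h := hne (Order.succ m)
  rw [cutSign] at h
  split_ifs at h with h1 h2
  · obtain ⟨l, hl, h3, _⟩ := h1
    exact key l (.inl hl) h3
  · obtain ⟨l, hl, h3, _⟩ := h2
    exact key l (.inr hl) h3
  · exact h rfl

theorem eq_of_agree {x y : Surreal.{u}} {c : Ordinal.{u}} (h : ∀ b < c, x.sign b = y.sign b)
    (hx : x.sign c = 0) (hy : y.sign c = 0) : x = y := by
  refine ext_sign fun a => ?_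
  by_cases ha : a < c
  · exact h a ha
  · rw [not_lt] at ha
    rw [(x.sign_eq_zero_iff a).2 (((x.sign_eq_zero_iff c).1 hx).trans ha),
      (y.sign_eq_zero_iff a).2 (((y.sign_eq_zero_iff c).1 hy).trans ha)]

theorem le_of_agree {x y : Surreal.{u}} {c : Ordinal.{u}} (h : ∀ b < c, x.sign b = y.sign b)
    (hx : x.sign c ≤ 0) (hy : 0 ≤ y.sign c) : x ≤ y := by
  rcases (hx.trans hy).lt_or_eq with h1 | h1
  · exact le_of_lt ⟨c, h, h1⟩
  · exact (eq_of_agree h (le_antisymm hx (h1 ▸ hy)) (le_antisymm (h1 ▸ hx) hy)).le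

theorem cutSign_cases (L R : Set Surreal.{u}) (a : Ordinal.{u}) :
    (cutSign L R a = 1 ∧ ∃ l ∈ L, (∀ b < a, l.sign b = cutSign L R b) ∧ 0 ≤ l.sign a) ∨
    (cutSign L R a ≠ 1 ∧ ∀ l ∈ L, (∀ b < a, l.sign b = cutSign L R b) → l.sign a < 0) := by
  rw [cutSign]
  split_ifs with h1 h2
  · exact .inl ⟨rfl, h1⟩
  · exact .inr ⟨by decide, fun l hl h => not_le.1 fun h' => h1 ⟨l, hl, h, h'⟩⟩
  · exact .inr ⟨by decide, fun l hl h => not_le.1 fun h' => h1 ⟨l, hl, h, h'⟩⟩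

theorem cutSign_cases' (L R : Set Surreal.{u}) (a : Ordinal.{u}) : cutSign L R a = 1 ∨
    (cutSign L R a = -1 ∧ ∃ r ∈ R, (∀ b < a, r.sign b = cutSign L R b) ∧ r.sign a ≤ 0) ∨
    (cutSign L R a = 0 ∧ ∀ r ∈ R, (∀ b < a, r.sign b = cutSign L R b) → 0 < r.sign a) := by
  rw [cutSign]
  split_ifs with h1 h2
  · exact .inl rfl
  · exact .inr (.inl ⟨rfl, h2⟩)
  · exact .inr (.inr ⟨rfl, fun l hl h => not_le.1 fun h' => h2 ⟨l, hl, h, h'⟩⟩)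

/-- For sets `L < R` there is a simplest number between `L` and `R`. -/
theorem exists_isCut (L R : Set Surreal.{u}) [Small.{u} L] [Small.{u} R]
    (h : ∀ l ∈ L, ∀ r ∈ R, l < r) : ∃ x, IsCut L R x := by
  obtain ⟨n, hn, hmin⟩ := WellFounded.has_min (wellFounded_lt (α := Ordinal.{u}))
    {a | cutSign L R a = 0} (exists_cutSign_eq_zero L R)
  have hn : cutSign L R n = 0 := hn
  have hmin : ∀ b < n, cutSign L R b ≠ 0 := fun b hb h0 => hmin b h0 hb
  let x : Surreal.{u} := ⟨n, fun a => if a < n then cutSign L R a else 0, fun a => by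
    by_cases ha : a < n
    · simp [ha, hmin a ha]
    · simp [ha, not_lt.1 ha]⟩
  have hx : ∀ a ≤ n, x.sign a = cutSign L R a := fun a ha => by
    rcases ha.lt_or_eq with h1 | rfl
    · simp [x, h1]
    · simp [x, hn]
  have hxn : ∀ a, n ≤ a → x.sign a = 0 := fun a ha => by simp [x, not_lt.2 ha]
  have hdiff : ∀ y : Surreal.{u}, ∃ c ≤ n, (∀ b < c, y.sign b = cutSign L R b) ∧
      (y.sign c ≠ cutSign L R c ∨ (c = n ∧ y = x)) := by
    intro y
    by_cases hy : y = x
    · subst hy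
      exact ⟨n, le_rfl, fun b hb => hx b hb.le, .inr ⟨rfl, rfl⟩⟩
    obtain ⟨c, hc, hd⟩ := exists_first_diff hy
    have hcn : c ≤ n := by
      by_contra! hlt
      have h1 := hc n hlt
      rw [hxn n le_rfl, y.sign_eq_zero_iff] at h1
      exact hd (by rw [hxn c hlt.le, y.sign_eq_zero_iff]; exact h1.trans hlt.le)
    exact ⟨c, hcn, fun b hb => (hc b hb).trans (hx b (hb.le.trans hcn)),
      .inl (fun h1 => hd (h1.trans (hx c hcn).symm))⟩
  refine ⟨x, ⟨fun l hl => ?_, fun r hr => ?_⟩, fun y hy => ?_⟩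
  · obtain ⟨c, hcn, hc, hd⟩ := hdiff l
    have hag : ∀ b < c, l.sign b = x.sign b :=
      fun b hb => (hc b hb).trans (hx b (hb.le.trans hcn)).symm
    rcases cutSign_cases L R c with ⟨h1, l', hl', h2, h3⟩ | ⟨h1, h2⟩
    · rcases hd with hd | ⟨rfl, -⟩
      · refine ⟨c, hag, ?_⟩
        rw [hx c hcn]
        rw [h1] at hd ⊢
        revert hd
        cases l.sign c <;> decide
      · rw [hn] at h1
        exact absurd h1 (by decide)
    · have h3 := h2 l hl hc
      rcases hd with hd | ⟨rfl, rfl⟩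
      · refine ⟨c, hag, ?_⟩
        rw [hx c hcn]
        revert hd h3
        cases l.sign c <;> cases cutSign L R c <;> decide
      · rw [hxn c le_rfl] at h3
        exact absurd h3 (by decide)
  · obtain ⟨c, hcn, hc, hd⟩ := hdiff r
    have hag : ∀ b < c, x.sign b = r.sign b :=
      fun b hb => (hx b (hb.le.trans hcn)).trans (hc b hb).symm
    rcases cutSign_cases' L R c with h1 | ⟨h1, h2⟩ | ⟨h1, h2⟩
    · rcases cutSign_cases L R c with ⟨-, l, hl, h2, h3⟩ | ⟨h2, -⟩
      · exfalso
        have hr0 : r.sign c ≤ 0 := by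
          by_contra hr0
          rcases hd with hd | ⟨rfl, rfl⟩
          · rw [h1] at hd
            revert hd hr0
            cases r.sign c <;> decide
          · rw [hn] at h1
            exact absurd h1 (by decide)
        have h4 := h l hl r hr
        exact absurd (le_of_agree (fun b hb => (hc b hb).trans (h2 b hb).symm) hr0 h3) h4.not_ge
      · exact absurd h1 h2
    · rcases hd with hd | ⟨rfl, -⟩
      · refine ⟨c, hag, ?_⟩
        rw [hx c hcn]
        rw [h1] at hd ⊢
        revert hd
        cases r.sign c <;> decide
      · rw [hn] at h1
        exact absurd h1 (by decide)
    · have h3 := h2 r hr hc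
      exact ⟨c, hag, by rw [hx c hcn, h1]; exact h3⟩
  · obtain ⟨c, hcn, hc, hd⟩ := hdiff y
    rcases hd with hd | ⟨rfl, rfl⟩
    · by_cases hcn' : c = n
      · subst hcn'
        refine ⟨?_, fun b hb => (hx b (le_of_lt hb)).trans (hc b hb).symm⟩
        change c ≤ y.length
        by_contra! hlt
        have h1 := hc y.length hlt
        rw [(y.sign_eq_zero_iff _).2 le_rfl] at h1
        exact hmin _ hlt h1.symm
      · exfalso
        have hcn : c < n := lt_of_le_of_ne hcn hcn'
        rcases cutSign_cases' L R c with h1 | ⟨h1, r, hr, h2, h3⟩ | ⟨h1, h2⟩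
        · rcases cutSign_cases L R c with ⟨-, l, hl, h2, h3⟩ | ⟨h2, -⟩
          · have hy0 : y.sign c ≤ 0 := by
              rw [h1] at hd
              revert hd
              cases y.sign c <;> decide
            exact absurd (le_of_agree (fun b hb => (hc b hb).trans (h2 b hb).symm) hy0 h3)
              (hy.1 l hl).not_ge
          · exact absurd h1 h2
        · have hy0 : 0 ≤ y.sign c := by
            rw [h1] at hd
            revert hd
            cases y.sign c <;> decide
          exact absurd (le_of_agree (fun b hb => (h2 b hb).trans (hc b hb).symm) h3 hy0)
            (hy.2 r hr).not_ge
        · exact hmin c hcn h1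
    · exact Simpler.refl _

theorem IsCut.eq_cut {L R : Set Surreal.{u}} {x : Surreal.{u}} (h : IsCut L R x) :
    x = cut L R := by
  have hex : ∃ x, IsCut L R x := ⟨x, h⟩
  rw [cut, dif_pos hex]
  exact (h.2 _ hex.choose_spec.1).antisymm (hex.choose_spec.2 _ h.1)

theorem isCut_cut (L R : Set Surreal.{u}) [Small.{u} L] [Small.{u} R]
    (h : ∀ l ∈ L, ∀ r ∈ R, l < r) : IsCut L R (cut L R) := by
  obtain ⟨x, hx⟩ := exists_isCut L R h
  exact hx.eq_cut ▸ hx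

theorem IsCut.exists_left {L R : Set Surreal.{u}} {x z : Surreal.{u}} (h : IsCut L R x)
    (hz : z ∈ leftOpts x) : ∃ l ∈ L, z ≤ l := by
  by_contra! hn
  exact (h.2 z ⟨hn, fun r hr => hz.1.trans (h.1.2 r hr)⟩).not_strictlySimpler hz.2

theorem IsCut.exists_right {L R : Set Surreal.{u}} {x z : Surreal.{u}} (h : IsCut L R x)
    (hz : z ∈ rightOpts x) : ∃ r ∈ R, r ≤ z := by
  by_contra! hn
  exact (h.2 z ⟨fun l hl => (h.1.1 l hl).trans hz.1, hn⟩).not_strictlySimpler hz.2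

theorem isCut_self (x : Surreal.{u}) : IsCut (leftOpts x) (rightOpts x) x := by
  refine ⟨⟨fun l hl => hl.1, fun r hr => hr.1⟩, fun y hy => ?_⟩
  by_contra hn
  obtain ⟨p, hp, -, ⟨h1, h2⟩ | ⟨h1, h2⟩⟩ := exists_of_not_simpler hn
  · exact absurd (hy.1 p ⟨h1, hp⟩) h2.not_gt
  · exact absurd (hy.2 p ⟨h1, hp⟩) h2.not_gt

theorem IsCut.eq_of {L R L' R' : Set Surreal.{u}} {x y : Surreal.{u}} (h : IsCut L R x)
    (h' : IsCut L' R' y) (h1 : y ∈ between L R) (h2 : x ∈ between L' R') : x = y :=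
  (h.2 y h1).antisymm (h'.2 x h2)

/-- A set of options cofinal with one that represents `x` represents `x`. -/
theorem IsCut.of_cofinal {L R L' R' : Set Surreal.{u}} {x : Surreal.{u}} (h : IsCut L R x)
    (h1 : x ∈ between L' R') (hL : ∀ l ∈ L, ∃ l' ∈ L', l ≤ l') (hR : ∀ r ∈ R, ∃ r' ∈ R', r' ≤ r) :
    IsCut L' R' x := by
  refine ⟨h1, fun y hy => h.2 y ⟨fun l hl => ?_, fun r hr => ?_⟩⟩
  · obtain ⟨l', hl', h2⟩ := hL l hl
    exact h2.trans_lt (hy.1 l' hl')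
  · obtain ⟨r', hr', h2⟩ := hR r hr
    exact (hy.2 r' hr').trans_le h2

instance small_setOf_strictlySimpler (x : Surreal.{u}) :
    Small.{u} {y : Surreal.{u} | StrictlySimpler y x} := by
  refine small_of_injective (β := Iio x.length) (f := fun y => ⟨y.1.length, y.2.1⟩) ?_
  rintro ⟨y, hy⟩ ⟨z, hz⟩ h
  have hl : y.length = z.length := congrArg Subtype.val h
  refine Subtype.ext (Simpler.antisymm ⟨hl.le, fun b hb => ?_⟩ ⟨hl.ge, fun b hb => ?_⟩)
  · rw [hy.2 b hb, hz.2 b (hl ▸ hb)]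
  · rw [hy.2 b (hl ▸ hb), hz.2 b hb]

instance small_leftOpts (x : Surreal.{u}) : Small.{u} (leftOpts x) :=
  small_of_injective (β := {y : Surreal.{u} | StrictlySimpler y x})
    (inclusion_injective fun _ h => h.2)

instance small_rightOpts (x : Surreal.{u}) : Small.{u} (rightOpts x) :=
  small_of_injective (β := {y : Surreal.{u} | StrictlySimpler y x})
    (inclusion_injective fun _ h => h.2)

theorem strictlySimpler_wf : WellFounded (StrictlySimpler : Surreal.{u} → Surreal.{u} → Prop) :=
  Subrelation.wf (fun h => h.1) (InvImage.wf length (wellFounded_lt (α := Ordinal.{u})))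

/-! ### Addition -/

/-- The options of `x + y` that come from the sets `A`, `B` of options of `x`, `y`. -/
def addOpts (x y : Surreal.{u}) (A B : Set Surreal.{u}) : Set Surreal.{u} :=
  (fun a => a + y) '' A ∪ (fun b => x + b) '' B

theorem add_def (x y : Surreal.{u}) : x + y = cut (addOpts x y (leftOpts x) (leftOpts y))
    (addOpts x y (rightOpts x) (rightOpts y)) := by
  change add x y = _
  rw [add]
  simp only [addOpts, image_eq_range]
  rfl

/-- The canonical representations of `x` and `y` give one of `x + y`. -/
def AddOK (x y : Surreal.{u}) : Prop := IsCut (addOpts x y (leftOpts x) (leftOpts y))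
  (addOpts x y (rightOpts x) (rightOpts y)) (x + y)

theorem add_lt_add_right_aux {a b y : Surreal.{u}} (h : a < b) (ha : AddOK a y) (hb : AddOK b y) :
    a + y < b + y := by
  rcases lt_cases h with h1 | h1 | ⟨m, h1, h2, h3, h4⟩
  · exact hb.1.1 _ (.inl ⟨a, ⟨h, h1⟩, rfl⟩)
  · exact ha.1.2 _ (.inl ⟨b, ⟨h, h1⟩, rfl⟩)
  · exact (ha.1.2 _ (.inl ⟨m, ⟨h3, h1⟩, rfl⟩)).trans (hb.1.1 _ (.inl ⟨m, ⟨h4, h2⟩, rfl⟩))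

theorem add_lt_add_left_aux {a b x : Surreal.{u}} (h : a < b) (ha : AddOK x a) (hb : AddOK x b) :
    x + a < x + b := by
  rcases lt_cases h with h1 | h1 | ⟨m, h1, h2, h3, h4⟩
  · exact hb.1.1 _ (.inr ⟨a, ⟨h, h1⟩, rfl⟩)
  · exact ha.1.2 _ (.inr ⟨b, ⟨h, h1⟩, rfl⟩)
  · exact (ha.1.2 _ (.inr ⟨m, ⟨h3, h1⟩, rfl⟩)).trans (hb.1.1 _ (.inr ⟨m, ⟨h4, h2⟩, rfl⟩))

theorem addOK (x y : Surreal.{u}) : AddOK x y := by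
  induction x using strictlySimpler_wf.induction generalizing y with | _ x ihx =>
  induction y using strictlySimpler_wf.induction with | _ y ihy =>
  rw [AddOK, add_def x y]
  have (A B : Set Surreal.{u}) [Small.{u} A] [Small.{u} B] : Small.{u} (addOpts x y A B) := by
    unfold addOpts; infer_instance
  refine isCut_cut _ _ ?_
  rintro _ (⟨a, ha, rfl⟩ | ⟨b, hb, rfl⟩) _ (⟨c, hc, rfl⟩ | ⟨d, hd, rfl⟩)
  · exact add_lt_add_right_aux (ha.1.trans hc.1) (ihx a ha.2 y) (ihx c hc.2 y)
  · exact (add_lt_add_left_aux hd.1 (ihx a ha.2 y) (ihx a ha.2 d)).trans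
      ((ihy d hd.2).1.1 _ (.inl ⟨a, ha, rfl⟩))
  · exact ((ihy b hb.2).1.2 _ (.inl ⟨c, hc, rfl⟩)).trans
      (add_lt_add_left_aux hb.1 (ihx c hc.2 b) (ihx c hc.2 y))
  · exact add_lt_add_left_aux (hb.1.trans hd.1) (ihy b hb.2) (ihy d hd.2)

theorem add_right_strict {a b : Surreal.{u}} (h : a < b) (y : Surreal.{u}) : a + y < b + y :=
  add_lt_add_right_aux h (addOK a y) (addOK b y)

theorem add_left_strict {a b : Surreal.{u}} (x : Surreal.{u}) (h : a < b) : x + a < x + b :=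
  add_lt_add_left_aux h (addOK x a) (addOK x b)

theorem add_right_mono {a b : Surreal.{u}} (h : a ≤ b) (y : Surreal.{u}) : a + y ≤ b + y := by
  rcases h.lt_or_eq with h | rfl
  · exact (add_right_strict h y).le
  · exact le_rfl

theorem add_left_mono {a b : Surreal.{u}} (x : Surreal.{u}) (h : a ≤ b) : x + a ≤ x + b := by
  rcases h.lt_or_eq with h | rfl
  · exact (add_left_strict x h).le
  · exact le_rfl

theorem mem_between_addOpts {L R L' R' : Set Surreal.{u}} {x y : Surreal.{u}}
    (hx : x ∈ between L R) (hy : y ∈ between L' R') :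
    x + y ∈ between (addOpts x y L L') (addOpts x y R R') := by
  constructor
  · rintro _ (⟨a, ha, rfl⟩ | ⟨b, hb, rfl⟩)
    · exact add_right_strict (hx.1 a ha) y
    · exact add_left_strict x (hy.1 b hb)
  · rintro _ (⟨a, ha, rfl⟩ | ⟨b, hb, rfl⟩)
    · exact add_right_strict (hx.2 a ha) y
    · exact add_left_strict x (hy.2 b hb)

/-- The sum may be computed from arbitrary representations. -/
theorem IsCut.add {L R L' R' : Set Surreal.{u}} {x y : Surreal.{u}} (hx : IsCut L R x)
    (hy : IsCut L' R' y) : IsCut (addOpts x y L L') (addOpts x y R R') (x + y) := by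
  refine (addOK x y).of_cofinal (mem_between_addOpts hx.1 hy.1) ?_ ?_
  · rintro _ (⟨a, ha, rfl⟩ | ⟨b, hb, rfl⟩)
    · obtain ⟨l, hl, h⟩ := hx.exists_left ha
      exact ⟨_, .inl ⟨l, hl, rfl⟩, add_right_mono h y⟩
    · obtain ⟨l, hl, h⟩ := hy.exists_left hb
      exact ⟨_, .inr ⟨l, hl, rfl⟩, add_left_mono x h⟩
  · rintro _ (⟨a, ha, rfl⟩ | ⟨b, hb, rfl⟩)
    · obtain ⟨l, hl, h⟩ := hx.exists_right ha
      exact ⟨_, .inl ⟨l, hl, rfl⟩, add_right_mono h y⟩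
    · obtain ⟨l, hl, h⟩ := hy.exists_right hb
      exact ⟨_, .inr ⟨l, hl, rfl⟩, add_left_mono x h⟩

theorem add_comm' (x y : Surreal.{u}) : x + y = y + x := by
  induction x using strictlySimpler_wf.induction generalizing y with | _ x ihx =>
  induction y using strictlySimpler_wf.induction with | _ y ihy =>
  refine (addOK x y).eq_of (addOK y x) ⟨?_, ?_⟩ ⟨?_, ?_⟩
  · rintro _ (⟨a, ha, rfl⟩ | ⟨b, hb, rfl⟩)
    · exact (ihx a ha.2 y).trans_lt (add_left_strict y ha.1)
    · exact (ihy b hb.2).trans_lt (add_right_strict hb.1 x)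
  · rintro _ (⟨a, ha, rfl⟩ | ⟨b, hb, rfl⟩)
    · exact (add_left_strict y ha.1).trans_eq (ihx a ha.2 y).symm
    · exact (add_right_strict hb.1 x).trans_eq (ihy b hb.2).symm
  · rintro _ (⟨a, ha, rfl⟩ | ⟨b, hb, rfl⟩)
    · exact (ihy a ha.2).symm.trans_lt (add_left_strict x ha.1)
    · exact (ihx b hb.2 y).symm.trans_lt (add_right_strict hb.1 y)
  · rintro _ (⟨a, ha, rfl⟩ | ⟨b, hb, rfl⟩)
    · exact (add_left_strict x ha.1).trans_eq (ihy a ha.2)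
    · exact (add_right_strict hb.1 y).trans_eq (ihx b hb.2 y)

theorem add_assoc' (x y z : Surreal.{u}) : x + y + z = x + (y + z) := by
  induction x using strictlySimpler_wf.induction generalizing y z with | _ x ihx =>
  induction y using strictlySimpler_wf.induction generalizing z with | _ y ihy =>
  induction z using strictlySimpler_wf.induction with | _ z ihz =>
  refine ((addOK x y).add (isCut_self z)).eq_of ((isCut_self x).add (addOK y z))
    ⟨?_, ?_⟩ ⟨?_, ?_⟩
  · rintro _ (⟨_, ⟨a, ha, rfl⟩ | ⟨a, ha, rfl⟩, rfl⟩ | ⟨a, ha, rfl⟩)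
    · exact (ihx a ha.2 y z).trans_lt (add_right_strict ha.1 _)
    · exact (ihy a ha.2 z).trans_lt (add_left_strict _ (add_right_strict ha.1 _))
    · exact (ihz a ha.2).trans_lt (add_left_strict _ (add_left_strict _ ha.1))
  · rintro _ (⟨_, ⟨a, ha, rfl⟩ | ⟨a, ha, rfl⟩, rfl⟩ | ⟨a, ha, rfl⟩)
    · exact (add_right_strict ha.1 _).trans_eq (ihx a ha.2 y z).symm
    · exact (add_left_strict _ (add_right_strict ha.1 _)).trans_eq (ihy a ha.2 z).symm
    · exact (add_left_strict _ (add_left_strict _ ha.1)).trans_eq (ihz a ha.2).symm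
  · rintro _ (⟨a, ha, rfl⟩ | ⟨_, ⟨a, ha, rfl⟩ | ⟨a, ha, rfl⟩, rfl⟩)
    · exact (ihx a ha.2 y z).symm.trans_lt (add_right_strict (add_right_strict ha.1 _) _)
    · exact (ihy a ha.2 z).symm.trans_lt (add_right_strict (add_left_strict _ ha.1) _)
    · exact (ihz a ha.2).symm.trans_lt (add_left_strict _ ha.1)
  · rintro _ (⟨a, ha, rfl⟩ | ⟨_, ⟨a, ha, rfl⟩ | ⟨a, ha, rfl⟩, rfl⟩)
    · exact (add_right_strict (add_right_strict ha.1 _) _).trans_eq (ihx a ha.2 y z)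
    · exact (add_right_strict (add_left_strict _ ha.1) _).trans_eq (ihy a ha.2 z)
    · exact (add_left_strict _ ha.1).trans_eq (ihz a ha.2)

theorem not_strictlySimpler_zero (x : Surreal.{u}) : ¬ StrictlySimpler x 0 := by
  intro h
  have h1 : x.length < 0 := h.1
  exact not_lt_bot h1

theorem zero_simpler (x : Surreal.{u}) : Simpler 0 x := by
  have h (b : Ordinal.{u}) : ¬ b < (0 : Surreal.{u}).length := not_lt_bot
  exact ⟨bot_le, fun b hb => absurd hb (h b)⟩

theorem add_zero' (x : Surreal.{u}) : x + 0 = x := by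
  induction x using strictlySimpler_wf.induction with | _ x ihx =>
  refine (addOK x 0).eq_of (isCut_self x) ⟨?_, ?_⟩ ⟨fun a ha => ?_, fun a ha => ?_⟩
  · rintro _ (⟨a, ha, rfl⟩ | ⟨a, ha, rfl⟩)
    · exact (ihx a ha.2).trans_lt ha.1
    · exact absurd ha.2 (not_strictlySimpler_zero a)
  · rintro _ (⟨a, ha, rfl⟩ | ⟨a, ha, rfl⟩)
    · exact ha.1.trans_eq (ihx a ha.2).symm
    · exact absurd ha.2 (not_strictlySimpler_zero a)
  · exact (ihx a ha.2).symm.trans_lt (add_right_strict ha.1 0)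
  · exact (add_right_strict ha.1 0).trans_eq (ihx a ha.2)

theorem neg_neg' (x : Surreal.{u}) : - -x = x :=
  ext_sign fun a => neg_neg (x.sign a)

theorem neg_lt_neg' {x y : Surreal.{u}} (h : x < y) : -y < -x := by
  obtain ⟨c, hc, hd⟩ := h
  refine ⟨c, fun b hb => congrArg Neg.neg (hc b hb).symm, ?_⟩
  change -y.sign c < -x.sign c
  revert hd
  cases x.sign c <;> cases y.sign c <;> decide

theorem StrictlySimpler.neg {x y : Surreal.{u}} (h : StrictlySimpler x y) :
    StrictlySimpler (-x) (-y) := ⟨h.1, fun b hb => congrArg Neg.neg (h.2 b hb)⟩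

theorem neg_mem_rightOpts {x y : Surreal.{u}} (h : y ∈ leftOpts (-x)) : -y ∈ rightOpts x := by
  rw [← neg_neg' x]
  exact ⟨neg_lt_neg' h.1, h.2.neg⟩

theorem neg_mem_leftOpts {x y : Surreal.{u}} (h : y ∈ rightOpts (-x)) : -y ∈ leftOpts x := by
  rw [← neg_neg' x]
  exact ⟨neg_lt_neg' h.1, h.2.neg⟩

theorem add_neg' (x : Surreal.{u}) : x + -x = 0 := by
  induction x using strictlySimpler_wf.induction with | _ x ihx =>
  refine ((addOK x (-x)).2 0 ⟨?_, ?_⟩).antisymm (zero_simpler _)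
  · rintro _ (⟨a, ha, rfl⟩ | ⟨a, ha, rfl⟩)
    · exact (add_left_strict a (neg_lt_neg' ha.1)).trans_eq (ihx a ha.2)
    · have h := neg_mem_rightOpts ha
      have h1 := ihx _ h.2
      rw [neg_neg'] at h1
      exact (add_right_strict h.1 a).trans_eq h1
  · rintro _ (⟨a, ha, rfl⟩ | ⟨a, ha, rfl⟩)
    · exact (ihx a ha.2).symm.trans_lt (add_left_strict a (neg_lt_neg' ha.1))
    · have h := neg_mem_leftOpts ha
      have h1 := ihx _ h.2
      rw [neg_neg'] at h1
      exact h1.symm.trans_lt (add_right_strict h.1 a)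

instance : AddCommGroup Surreal.{u} where
  add_assoc := add_assoc'
  zero_add x := (add_comm' 0 x).trans (add_zero' x)
  add_zero := add_zero'
  neg_add_cancel x := (add_comm' (-x) x).trans (add_neg' x)
  add_comm := add_comm'
  nsmul := nsmulRec
  zsmul := zsmulRec
  sub_eq_add_neg _ _ := rfl

instance : IsOrderedAddMonoid Surreal.{u} where
  add_le_add_left _ _ h c := add_right_mono h c

/-! ### Multiplication -/

/-- The option of `x y` that comes from options `a`, `b` of `x`, `y`. -/
def mulOpt (x y a b : Surreal.{u}) : Surreal.{u} := a * y + x * b - a * b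

/-- The options of `x y` that come from pairs of options in `A × B` and in `C × D`. -/
def mulOpts (x y : Surreal.{u}) (A B C D : Set Surreal.{u}) : Set Surreal.{u} :=
  image2 (mulOpt x y) A B ∪ image2 (mulOpt x y) C D

theorem mul_def (x y : Surreal.{u}) : x * y =
    cut (mulOpts x y (leftOpts x) (leftOpts y) (rightOpts x) (rightOpts y))
      (mulOpts x y (leftOpts x) (rightOpts y) (rightOpts x) (leftOpts y)) := by
  have key (A B : Set Surreal.{u}) : range (fun p : A × B =>
      mul p.1.1 y + mul x p.2.1 - mul p.1.1 p.2.1) = image2 (mulOpt x y) A B := by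
    ext z
    constructor
    · rintro ⟨p, rfl⟩
      exact ⟨p.1, p.1.2, p.2, p.2.2, rfl⟩
    · rintro ⟨a, ha, b, hb, rfl⟩
      exact ⟨(⟨a, ha⟩, ⟨b, hb⟩), rfl⟩
  change mul x y = _
  rw [mul]
  simp only [key, mulOpts]

/-- The canonical representations of `x` and `y` give one of `x y`. -/
def MulOK (x y : Surreal.{u}) : Prop :=
  IsCut (mulOpts x y (leftOpts x) (leftOpts y) (rightOpts x) (rightOpts y))
    (mulOpts x y (leftOpts x) (rightOpts y) (rightOpts x) (leftOpts y)) (x * y)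

theorem MulOK.ll {x y a b : Surreal.{u}} (h : MulOK x y) (ha : a ∈ leftOpts x)
    (hb : b ∈ leftOpts y) : a * y + x * b < a * b + x * y := by
  have := h.1.1 _ (.inl ⟨a, ha, b, hb, rfl⟩)
  rw [mulOpt] at this
  grind

theorem MulOK.rr {x y a b : Surreal.{u}} (h : MulOK x y) (ha : a ∈ rightOpts x)
    (hb : b ∈ rightOpts y) : a * y + x * b < a * b + x * y := by
  have := h.1.1 _ (.inr ⟨a, ha, b, hb, rfl⟩)
  rw [mulOpt] at this
  grind

theorem MulOK.lr {x y a b : Surreal.{u}} (h : MulOK x y) (ha : a ∈ leftOpts x)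
    (hb : b ∈ rightOpts y) : a * b + x * y < a * y + x * b := by
  have := h.1.2 _ (.inl ⟨a, ha, b, hb, rfl⟩)
  rw [mulOpt] at this
  grind

theorem MulOK.rl {x y a b : Surreal.{u}} (h : MulOK x y) (ha : a ∈ rightOpts x)
    (hb : b ∈ leftOpts y) : a * b + x * y < a * y + x * b := by
  have := h.1.2 _ (.inr ⟨a, ha, b, hb, rfl⟩)
  rw [mulOpt] at this
  grind

theorem cross_aux_left {a b c d : Surreal.{u}} (hab : a ∈ leftOpts b) (hcd : c < d)
    (hc : MulOK b c) (hd : MulOK b d) : a * d + b * c < a * c + b * d := by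
  rcases lt_cases hcd with h | h | ⟨m, h1, h2, h3, h4⟩
  · exact hd.ll hab ⟨hcd, h⟩
  · have := hc.lr hab ⟨hcd, h⟩
    grind
  · have e1 := hc.lr hab ⟨h3, h1⟩
    have e2 := hd.ll hab ⟨h4, h2⟩
    grind

theorem cross_aux_right {a b c d : Surreal.{u}} (hab : b ∈ rightOpts a) (hcd : c < d)
    (hc : MulOK a c) (hd : MulOK a d) : a * d + b * c < a * c + b * d := by
  rcases lt_cases hcd with h | h | ⟨m, h1, h2, h3, h4⟩
  · have := hd.rl hab ⟨hcd, h⟩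
    grind
  · have := hc.rr hab ⟨hcd, h⟩
    grind
  · have e1 := hc.rr hab ⟨h3, h1⟩
    have e2 := hd.rl hab ⟨h4, h2⟩
    grind

theorem cross_aux {a b c d : Surreal.{u}} (hab : a < b) (hcd : c < d) (h1 : MulOK a c)
    (h2 : MulOK a d) (h3 : MulOK b c) (h4 : MulOK b d) : a * d + b * c < a * c + b * d := by
  rcases lt_cases hab with h | h | ⟨m, m1, m2, m3, m4⟩
  · exact cross_aux_left ⟨hab, h⟩ hcd h3 h4
  · exact cross_aux_right ⟨hab, h⟩ hcd h1 h2
  · have e1 := cross_aux_right ⟨m3, m1⟩ hcd h1 h2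
    have e2 := cross_aux_left ⟨m4, m2⟩ hcd h3 h4
    grind

theorem cross_aux_le {a b c d : Surreal.{u}} (hab : a ≤ b) (hcd : c ≤ d) (h1 : MulOK a c)
    (h2 : MulOK a d) (h3 : MulOK b c) (h4 : MulOK b d) : a * d + b * c ≤ a * c + b * d := by
  rcases hab.lt_or_eq with hab | rfl
  · rcases hcd.lt_or_eq with hcd | rfl
    · exact (cross_aux hab hcd h1 h2 h3 h4).le
    · exact le_rfl
  · exact (add_comm _ _).le

theorem mulOK (x y : Surreal.{u}) : MulOK x y := by
  induction x using strictlySimpler_wf.induction generalizing y with | _ x ihx =>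
  induction y using strictlySimpler_wf.induction with | _ y ihy =>
  rw [MulOK, mul_def x y]
  have (A B C D : Set Surreal.{u}) [Small.{u} A] [Small.{u} B] [Small.{u} C] [Small.{u} D] :
      Small.{u} (mulOpts x y A B C D) := by
    unfold mulOpts; infer_instance
  refine isCut_cut _ _ ?_
  rintro _ (⟨a, ha, b, hb, rfl⟩ | ⟨a, ha, b, hb, rfl⟩) _
    (⟨c, hc, d, hd, rfl⟩ | ⟨c, hc, d, hd, rfl⟩)
  all_goals
    have a1 := fun z => ihx a ha.2 z
    have c1 := fun z => ihx c hc.2 z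
    have b1 := ihy b hb.2
    have d1 := ihy d hd.2
    simp only [mulOpt]
  · rcases le_total a c with h | h
    · have e1 := cross_aux_le h hb.1.le (a1 _) (a1 _) (c1 _) (c1 _)
      have e2 := cross_aux hc.1 (hb.1.trans hd.1) (c1 _) (c1 _) b1 d1
      grind
    · have e1 := cross_aux_le h hd.1.le (c1 _) (c1 _) (a1 _) (a1 _)
      have e2 := cross_aux ha.1 (hb.1.trans hd.1) (a1 _) (a1 _) b1 d1
      grind
  · rcases le_total b d with h | h
    · have e1 := cross_aux_le ha.1.le h (a1 _) (a1 _) b1 d1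
      have e2 := cross_aux (ha.1.trans hc.1) hd.1 (a1 _) (a1 _) (c1 _) (c1 _)
      grind
    · have e1 := cross_aux_le hc.1.le h d1 b1 (c1 _) (c1 _)
      have e2 := cross_aux (ha.1.trans hc.1) hb.1 (a1 _) (a1 _) (c1 _) (c1 _)
      grind
  · rcases le_total b d with h | h
    · have e1 := cross_aux_le hc.1.le h (c1 _) (c1 _) b1 d1
      have e2 := cross_aux (hc.1.trans ha.1) hb.1 (c1 _) (c1 _) (a1 _) (a1 _)
      grind
    · have e1 := cross_aux_le ha.1.le h d1 b1 (a1 _) (a1 _)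
      have e2 := cross_aux (hc.1.trans ha.1) hd.1 (c1 _) (c1 _) (a1 _) (a1 _)
      grind
  · rcases le_total a c with h | h
    · have e1 := cross_aux_le h hd.1.le (a1 _) (a1 _) (c1 _) (c1 _)
      have e2 := cross_aux ha.1 (hd.1.trans hb.1) d1 b1 (a1 _) (a1 _)
      grind
    · have e1 := cross_aux_le h hb.1.le (c1 _) (c1 _) (a1 _) (a1 _)
      have e2 := cross_aux hc.1 (hd.1.trans hb.1) d1 b1 (c1 _) (c1 _)
      grind

theorem cross {a b c d : Surreal.{u}} (hab : a < b) (hcd : c < d) :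
    a * d + b * c < a * c + b * d :=
  cross_aux hab hcd (mulOK _ _) (mulOK _ _) (mulOK _ _) (mulOK _ _)

theorem cross_le {a b c d : Surreal.{u}} (hab : a ≤ b) (hcd : c ≤ d) :
    a * d + b * c ≤ a * c + b * d :=
  cross_aux_le hab hcd (mulOK _ _) (mulOK _ _) (mulOK _ _) (mulOK _ _)

theorem mem_between_mulOpts {L R L' R' : Set Surreal.{u}} {x y : Surreal.{u}}
    (hx : x ∈ between L R) (hy : y ∈ between L' R') :
    x * y ∈ between (mulOpts x y L L' R R') (mulOpts x y L R' R L') := by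
  constructor
  · rintro _ (⟨a, ha, b, hb, rfl⟩ | ⟨a, ha, b, hb, rfl⟩)
    · have := cross (hx.1 a ha) (hy.1 b hb)
      rw [mulOpt]
      grind
    · have := cross (hx.2 a ha) (hy.2 b hb)
      rw [mulOpt]
      grind
  · rintro _ (⟨a, ha, b, hb, rfl⟩ | ⟨a, ha, b, hb, rfl⟩)
    · have := cross (hx.1 a ha) (hy.2 b hb)
      rw [mulOpt]
      grind
    · have := cross (hx.2 a ha) (hy.1 b hb)
      rw [mulOpt]
      grind

/-- The product may be computed from arbitrary representations. -/
theorem IsCut.mul {L R L' R' : Set Surreal.{u}} {x y : Surreal.{u}} (hx : IsCut L R x)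
    (hy : IsCut L' R' y) : IsCut (mulOpts x y L L' R R') (mulOpts x y L R' R L') (x * y) := by
  refine (mulOK x y).of_cofinal (mem_between_mulOpts hx.1 hy.1) ?_ ?_
  · rintro _ (⟨a, ha, b, hb, rfl⟩ | ⟨a, ha, b, hb, rfl⟩)
    · obtain ⟨l, hl, h⟩ := hx.exists_left ha
      obtain ⟨m, hm, h'⟩ := hy.exists_left hb
      refine ⟨_, .inl ⟨l, hl, m, hm, rfl⟩, ?_⟩
      have e1 := cross_le h hb.1.le
      have e2 := cross_le (hx.1.1 l hl).le h'
      simp only [mulOpt]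
      grind
    · obtain ⟨l, hl, h⟩ := hx.exists_right ha
      obtain ⟨m, hm, h'⟩ := hy.exists_right hb
      refine ⟨_, .inr ⟨l, hl, m, hm, rfl⟩, ?_⟩
      have e1 := cross_le h hb.1.le
      have e2 := cross_le (hx.1.2 l hl).le h'
      simp only [mulOpt]
      grind
  · rintro _ (⟨a, ha, b, hb, rfl⟩ | ⟨a, ha, b, hb, rfl⟩)
    · obtain ⟨l, hl, h⟩ := hx.exists_left ha
      obtain ⟨m, hm, h'⟩ := hy.exists_right hb
      refine ⟨_, .inl ⟨l, hl, m, hm, rfl⟩, ?_⟩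
      have e1 := cross_le h hb.1.le
      have e2 := cross_le (hx.1.1 l hl).le h'
      simp only [mulOpt]
      grind
    · obtain ⟨l, hl, h⟩ := hx.exists_right ha
      obtain ⟨m, hm, h'⟩ := hy.exists_left hb
      refine ⟨_, .inr ⟨l, hl, m, hm, rfl⟩, ?_⟩
      have e1 := cross_le h hb.1.le
      have e2 := cross_le (hx.1.2 l hl).le h'
      simp only [mulOpt]
      grind

theorem mul_comm' (x y : Surreal.{u}) : x * y = y * x := by
  induction x using strictlySimpler_wf.induction generalizing y with | _ x ihx =>
  induction y using strictlySimpler_wf.induction with | _ y ihy =>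
  refine (mulOK x y).eq_of (mulOK y x) ⟨?_, ?_⟩ ⟨?_, ?_⟩
  · rintro _ (⟨a, ha, b, hb, rfl⟩ | ⟨a, ha, b, hb, rfl⟩)
    all_goals
      have e1 := cross ha.1 hb.1
      have e2 := cross hb.1 ha.1
      rw [mulOpt, ihx a ha.2 y, ihy b hb.2, ihx a ha.2 b]
      grind
  · rintro _ (⟨a, ha, b, hb, rfl⟩ | ⟨a, ha, b, hb, rfl⟩)
    all_goals
      have e1 := cross ha.1 hb.1
      have e2 := cross hb.1 ha.1
      rw [mulOpt, ihx a ha.2 y, ihy b hb.2, ihx a ha.2 b]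
      grind
  · rintro _ (⟨b, hb, a, ha, rfl⟩ | ⟨b, hb, a, ha, rfl⟩)
    all_goals
      have e1 := cross ha.1 hb.1
      have e2 := cross hb.1 ha.1
      rw [mulOpt, ← ihx a ha.2 y, ← ihy b hb.2, ← ihx a ha.2 b]
      grind
  · rintro _ (⟨b, hb, a, ha, rfl⟩ | ⟨b, hb, a, ha, rfl⟩)
    all_goals
      have e1 := cross ha.1 hb.1
      have e2 := cross hb.1 ha.1
      rw [mulOpt, ← ihx a ha.2 y, ← ihy b hb.2, ← ihx a ha.2 b]
      grind

theorem mul_zero' (x : Surreal.{u}) : x * 0 = 0 := by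
  refine ((mulOK x 0).2 0 ⟨?_, ?_⟩).antisymm (zero_simpler _)
  · rintro _ (⟨a, ha, b, hb, rfl⟩ | ⟨a, ha, b, hb, rfl⟩)
    all_goals exact absurd hb.2 (not_strictlySimpler_zero b)
  · rintro _ (⟨a, ha, b, hb, rfl⟩ | ⟨a, ha, b, hb, rfl⟩)
    all_goals exact absurd hb.2 (not_strictlySimpler_zero b)

theorem zero_mem_leftOpts_one : (0 : Surreal.{u}) ∈ leftOpts 1 := by
  have h : StrictlySimpler (0 : Surreal.{u}) 1 := by
    refine (zero_simpler 1).strictlySimpler fun h => ?_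
    have h1 : (0 : Ordinal.{u}) = 1 := congrArg length h
    exact zero_ne_one h1
  refine ⟨⟨0, fun b hb => absurd hb not_lt_bot, ?_⟩, h⟩
  change (0 : SignType) < if (0 : Ordinal.{u}) < 1 then 1 else 0
  rw [if_pos zero_lt_one]
  decide

theorem eq_zero_of_strictlySimpler_one {x : Surreal.{u}} (h : StrictlySimpler x 1) : x = 0 := by
  have h1 : x.length < 1 := h.1
  have h2 : x.length = 0 := Order.lt_one_iff.1 h1
  refine Simpler.antisymm ⟨h2.le, fun b hb => ?_⟩ (zero_simpler x)
  rw [h2] at hb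
  exact absurd hb not_lt_bot

theorem mul_one' (x : Surreal.{u}) : x * 1 = x := by
  induction x using strictlySimpler_wf.induction with | _ x ihx =>
  refine (mulOK x 1).eq_of (isCut_self x) ⟨?_, ?_⟩ ⟨fun a ha => ?_, fun a ha => ?_⟩
  · rintro _ (⟨a, ha, b, hb, rfl⟩ | ⟨a, ha, b, hb, rfl⟩)
    · rw [mulOpt, eq_zero_of_strictlySimpler_one hb.2, ihx a ha.2, mul_zero', mul_zero']
      simpa using ha.1
    · exact absurd (eq_zero_of_strictlySimpler_one hb.2 ▸ hb.1) zero_mem_leftOpts_one.1.asymm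
  · rintro _ (⟨a, ha, b, hb, rfl⟩ | ⟨a, ha, b, hb, rfl⟩)
    · exact absurd (eq_zero_of_strictlySimpler_one hb.2 ▸ hb.1) zero_mem_leftOpts_one.1.asymm
    · rw [mulOpt, eq_zero_of_strictlySimpler_one hb.2, ihx a ha.2, mul_zero', mul_zero']
      simpa using ha.1
  · have h := cross ha.1 zero_mem_leftOpts_one.1
    rw [ihx a ha.2, mul_zero', mul_zero'] at h
    simpa using h
  · have h := cross ha.1 zero_mem_leftOpts_one.1
    rw [ihx a ha.2, mul_zero', mul_zero'] at h
    simpa using h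

theorem mul_add' (x y z : Surreal.{u}) : x * (y + z) = x * y + x * z := by
  induction x using strictlySimpler_wf.induction generalizing y z with | _ x ihx =>
  induction y using strictlySimpler_wf.induction generalizing z with | _ y ihy =>
  induction z using strictlySimpler_wf.induction with | _ z ihz =>
  refine ((isCut_self x).mul (addOK y z)).eq_of ((mulOK x y).add (mulOK x z))
    ⟨?_, ?_⟩ ⟨?_, ?_⟩
  · rintro _ (⟨a, ha, _, ⟨b, hb, rfl⟩ | ⟨b, hb, rfl⟩, rfl⟩ |
      ⟨a, ha, _, ⟨b, hb, rfl⟩ | ⟨b, hb, rfl⟩, rfl⟩)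
    all_goals
      have e := cross ha.1 hb.1
      simp only [mulOpt, ihx a ha.2]
      first | rw [ihy b hb.2 z] | rw [ihz b hb.2]
      grind
  · rintro _ (⟨a, ha, _, ⟨b, hb, rfl⟩ | ⟨b, hb, rfl⟩, rfl⟩ |
      ⟨a, ha, _, ⟨b, hb, rfl⟩ | ⟨b, hb, rfl⟩, rfl⟩)
    all_goals
      have e := cross ha.1 hb.1
      simp only [mulOpt, ihx a ha.2]
      first | rw [ihy b hb.2 z] | rw [ihz b hb.2]
      grind
  · rintro _ (⟨_, ⟨a, ha, b, hb, rfl⟩ | ⟨a, ha, b, hb, rfl⟩, rfl⟩ |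
      ⟨_, ⟨a, ha, b, hb, rfl⟩ | ⟨a, ha, b, hb, rfl⟩, rfl⟩)
    · have e := cross ha.1 (add_right_strict hb.1 z)
      rw [ihx a ha.2, ihx a ha.2, ihy b hb.2 z] at e
      simp only [mulOpt]
      grind
    · have e := cross ha.1 (add_right_strict hb.1 z)
      rw [ihx a ha.2, ihx a ha.2, ihy b hb.2 z] at e
      simp only [mulOpt]
      grind
    · have e := cross ha.1 (add_left_strict y hb.1)
      rw [ihx a ha.2, ihx a ha.2, ihz b hb.2] at e
      simp only [mulOpt]
      grind
    · have e := cross ha.1 (add_left_strict y hb.1)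
      rw [ihx a ha.2, ihx a ha.2, ihz b hb.2] at e
      simp only [mulOpt]
      grind
  · rintro _ (⟨_, ⟨a, ha, b, hb, rfl⟩ | ⟨a, ha, b, hb, rfl⟩, rfl⟩ |
      ⟨_, ⟨a, ha, b, hb, rfl⟩ | ⟨a, ha, b, hb, rfl⟩, rfl⟩)
    · have e := cross ha.1 (add_right_strict hb.1 z)
      rw [ihx a ha.2, ihx a ha.2, ihy b hb.2 z] at e
      simp only [mulOpt]
      grind
    · have e := cross ha.1 (add_right_strict hb.1 z)
      rw [ihx a ha.2, ihx a ha.2, ihy b hb.2 z] at e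
      simp only [mulOpt]
      grind
    · have e := cross ha.1 (add_left_strict y hb.1)
      rw [ihx a ha.2, ihx a ha.2, ihz b hb.2] at e
      simp only [mulOpt]
      grind
    · have e := cross ha.1 (add_left_strict y hb.1)
      rw [ihx a ha.2, ihx a ha.2, ihz b hb.2] at e
      simp only [mulOpt]
      grind

instance : NonUnitalNonAssocCommRing Surreal.{u} where
  left_distrib := mul_add'
  right_distrib x y z := by rw [mul_comm', mul_add', mul_comm' z, mul_comm' z]
  zero_mul x := (mul_comm' 0 x).trans (mul_zero' x)
  mul_zero := mul_zero'
  mul_comm := mul_comm'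

theorem mul_pp {a b : Surreal.{u}} (ha : 0 < a) (hb : 0 < b) : 0 < a * b := by
  simpa using cross ha hb

theorem mul_pn {a b : Surreal.{u}} (ha : 0 < a) (hb : b < 0) : a * b < 0 := by
  simpa using cross ha hb

theorem mul_np {a b : Surreal.{u}} (ha : a < 0) (hb : 0 < b) : a * b < 0 := by
  simpa using cross ha hb

theorem mul_nn {a b : Surreal.{u}} (ha : a < 0) (hb : b < 0) : 0 < a * b := by
  simpa using cross ha hb

theorem mul_assoc' (x y z : Surreal.{u}) : x * y * z = x * (y * z) := by
  induction x using strictlySimpler_wf.induction generalizing y z with | _ x ihx =>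
  induction y using strictlySimpler_wf.induction generalizing z with | _ y ihy =>
  induction z using strictlySimpler_wf.induction with | _ z ihz =>
  refine ((mulOK x y).mul (isCut_self z)).eq_of ((isCut_self x).mul (mulOK y z))
    ⟨?_, ?_⟩ ⟨?_, ?_⟩
  on_goal 1 => rintro _ (⟨_, ⟨a, ha, b, hb, rfl⟩ | ⟨a, ha, b, hb, rfl⟩, c, hc, rfl⟩ |
      ⟨_, ⟨a, ha, b, hb, rfl⟩ | ⟨a, ha, b, hb, rfl⟩, c, hc, rfl⟩)
  on_goal 5 => rintro _ (⟨_, ⟨a, ha, b, hb, rfl⟩ | ⟨a, ha, b, hb, rfl⟩, c, hc, rfl⟩ |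
      ⟨_, ⟨a, ha, b, hb, rfl⟩ | ⟨a, ha, b, hb, rfl⟩, c, hc, rfl⟩)
  on_goal 9 => rintro _ (⟨a, ha, _, ⟨b, hb, c, hc, rfl⟩ | ⟨b, hb, c, hc, rfl⟩, rfl⟩ |
      ⟨a, ha, _, ⟨b, hb, c, hc, rfl⟩ | ⟨b, hb, c, hc, rfl⟩, rfl⟩)
  on_goal 13 => rintro _ (⟨a, ha, _, ⟨b, hb, c, hc, rfl⟩ | ⟨b, hb, c, hc, rfl⟩, rfl⟩ |
      ⟨a, ha, _, ⟨b, hb, c, hc, rfl⟩ | ⟨b, hb, c, hc, rfl⟩, rfl⟩)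
  all_goals
    have h1 := ihx a ha.2 y z
    have h2 := ihx a ha.2 b z
    have h3 := ihx a ha.2 y c
    have h4 := ihx a ha.2 b c
    have h5 := ihy b hb.2 z
    have h6 := ihy b hb.2 c
    have h7 := ihz c hc.2
    first
      | have s1 : 0 < x - a := sub_pos.2 ha.1
      | have s1 : x - a < 0 := sub_neg.2 ha.1
    first
      | have s2 : 0 < y - b := sub_pos.2 hb.1
      | have s2 : y - b < 0 := sub_neg.2 hb.1
    first
      | have s3 : 0 < z - c := sub_pos.2 hc.1
      | have s3 : z - c < 0 := sub_neg.2 hc.1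
    first
      | have s4 := mul_pp s2 s3
      | have s4 := mul_pn s2 s3
      | have s4 := mul_np s2 s3
      | have s4 := mul_nn s2 s3
    first
      | have s5 := mul_pp s1 s4
      | have s5 := mul_pn s1 s4
      | have s5 := mul_np s1 s4
      | have s5 := mul_nn s1 s4
    first
      | have t4 := mul_pp s1 s2
      | have t4 := mul_pn s1 s2
      | have t4 := mul_np s1 s2
      | have t4 := mul_nn s1 s2
    first
      | have t5 := mul_pp t4 s3
      | have t5 := mul_pn t4 s3
      | have t5 := mul_np t4 s3
      | have t5 := mul_nn t4 s3
    simp only [mul_sub, sub_mul, h1, h2, h3, h4, h5, h6, h7] at s5 t5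
    simp only [mulOpt, add_mul, sub_mul, mul_add, mul_sub, h1, h2, h3, h4, h5, h6, h7]
    first
      | (rw [← sub_pos]; refine s5.trans_eq ?_; abel1)
      | (rw [← sub_neg]; refine lt_of_eq_of_lt ?_ s5; abel1)
      | (rw [← sub_pos]; refine t5.trans_eq ?_; abel1)
      | (rw [← sub_neg]; refine lt_of_eq_of_lt ?_ t5; abel1)

/-- The surreal numbers are a commutative ring. -/
instance : CommRing Surreal.{u} where
  mul_assoc := mul_assoc'
  one_mul x := (mul_comm' 1 x).trans (mul_one' x)
  mul_one := mul_one'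
  left_distrib := mul_add'
  right_distrib := add_mul
  zero_mul := zero_mul
  mul_zero := mul_zero
  mul_comm := mul_comm'
  zsmul := zsmulRec
  neg_add_cancel := neg_add_cancel

end

end Surreal

/-!
The subring `B` generated by any initial class of surreal numbers is initial, and the theorem is
the case of the class `K ∪ {c}`.

Both facts rest on `Surreal.IsCut.exists_simpler`: if `x = {L | R}`, then a number strictly simpler
than `x` is simpler than or equal to some element of `L ∪ R`. Indeed, a strictly simpler `z < x`
satisfies `z ≤ l < x` for some `l ∈ L`, and the class of the numbers that extend `z` is convex;
the case `x < z` is symmetric. For `c = {L | R}` with `L, R ⊆ K` this shows that `K ∪ {c}` is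
initial. For a general initial class of generators, consider the numbers all of whose initial
segments lie in `B` (`Surreal.initialCore`). They are closed under addition and multiplication, by
induction on the two arguments: a proper initial segment of `x + y` is an initial segment of an
option `x' + y` or `x + y'`, and one of `x y` is an initial segment of an option
`x' y + x y' - x' y'`. So they form a subring; it contains the generators, hence equals `B`.
-/

namespace Surreal

theorem StrictlySimpler.simpler {x y : Surreal.{u}} (h : StrictlySimpler x y) : Simpler x y :=
  ⟨h.1.le, h.2⟩

theorem Simpler.trans {x y z : Surreal.{u}} (h : Simpler x y) (h' : Simpler y z) : Simpler x z :=
  ⟨h.1.trans h'.1, fun b hb => (h.2 b hb).trans (h'.2 b (hb.trans_le h.1))⟩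

theorem Simpler.neg {x y : Surreal.{u}} (h : Simpler x y) : Simpler (-x) (-y) :=
  ⟨h.1, fun b hb => congrArg Neg.neg (h.2 b hb)⟩

/-- If `p` is strictly simpler than `z`, then the extensions of `z` lie on the same side of `p`
as `z`. -/
theorem Simpler.lt_of_lt_left {p z x : Surreal.{u}} (h : Simpler z x) (hp : StrictlySimpler p z)
    (hlt : z < p) : x < p := by
  obtain ⟨c, hc, hd⟩ := hlt
  have hcz : c < z.length := by
    by_contra! hn
    rw [(z.sign_eq_zero_iff c).2 hn, (p.sign_eq_zero_iff c).2 (hp.1.le.trans hn)] at hd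
    exact lt_irrefl _ hd
  exact ⟨c, fun b hb => (h.2 b (hb.trans hcz)).symm.trans (hc b hb), h.2 c hcz ▸ hd⟩

/-- The class of the extensions of `z` is convex: the part on the right of `z`. -/
theorem Simpler.of_le_of_lt {z w x : Surreal.{u}} (h : Simpler z x) (h1 : z ≤ w) (h2 : w < x) :
    Simpler z w := by
  by_contra hn
  obtain ⟨p, hp, -, ⟨h3, h4⟩ | ⟨h3, h4⟩⟩ := exists_of_not_simpler hn
  · exact absurd (h4.trans_lt h3) h1.not_gt
  · exact absurd (h.lt_of_lt_left hp h3) (h4.trans h2.le).not_gt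

/-- The class of the extensions of `z` is convex: the part on the left of `z`. -/
theorem Simpler.of_lt_of_le {z w x : Surreal.{u}} (h : Simpler z x) (h1 : x < w) (h2 : w ≤ z) :
    Simpler z w := by
  have key := h.neg.of_le_of_lt (neg_le_neg h2) (neg_lt_neg' h1)
  rw [← neg_neg' z, ← neg_neg' w]
  exact key.neg

theorem IsCut.exists_simpler {L R : Set Surreal.{u}} {x z : Surreal.{u}} (h : IsCut L R x)
    (hz : StrictlySimpler z x) : ∃ w ∈ L ∪ R, Simpler z w := by
  rcases lt_or_gt_of_ne hz.ne with hlt | hlt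
  · obtain ⟨l, hl, hzl⟩ := h.exists_left ⟨hlt, hz⟩
    exact ⟨l, .inl hl, hz.simpler.of_le_of_lt hzl (h.1.1 l hl)⟩
  · obtain ⟨r, hr, hrz⟩ := h.exists_right ⟨hlt, hz⟩
    exact ⟨r, .inr hr, hz.simpler.of_lt_of_le (h.1.2 r hr) hrz⟩

/-- The class of the numbers all of whose initial segments lie in `B`, the largest initial class
contained in `B`. -/
def initialCore (B : Set Surreal.{u}) : Set Surreal.{u} := {x | ∀ z, Simpler z x → z ∈ B}

theorem initialCore_subset (B : Set Surreal.{u}) : initialCore B ⊆ B :=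
  fun x hx => hx x (Simpler.refl x)

theorem isInitial_initialCore (B : Set Surreal.{u}) : IsInitial (initialCore B) :=
  fun _ hx _ hy z hz => hx z (hz.trans hy)

theorem IsInitial.subset_initialCore {A B : Set Surreal.{u}} (hA : IsInitial A) (h : A ⊆ B) :
    A ⊆ initialCore B := fun x hx z hz => h (hA x hx z hz)

theorem IsCut.mem_initialCore {B L R : Set Surreal.{u}} {x : Surreal.{u}} (h : IsCut L R x)
    (hx : x ∈ B) (hLR : L ∪ R ⊆ initialCore B) : x ∈ initialCore B := by
  intro z hz
  by_cases hzx : z = x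
  · exact hzx ▸ hx
  · obtain ⟨w, hw, hzw⟩ := h.exists_simpler (hz.strictlySimpler hzx)
    exact hLR hw z hzw

section Subring

variable (B : Subring Surreal.{u})

theorem add_mem_initialCore {x y : Surreal.{u}} (hx : x ∈ initialCore (B : Set Surreal.{u}))
    (hy : y ∈ initialCore (B : Set Surreal.{u})) :
    x + y ∈ initialCore (B : Set Surreal.{u}) := by
  induction x using strictlySimpler_wf.induction generalizing y with | _ x ihx =>
  induction y using strictlySimpler_wf.induction with | _ y ihy =>
  have hl (a : Surreal.{u}) (ha : StrictlySimpler a x) :=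
    ihx a ha (isInitial_initialCore _ x hx a ha.simpler) hy
  have hr (b : Surreal.{u}) (hb : StrictlySimpler b y) :=
    ihy b hb (isInitial_initialCore _ y hy b hb.simpler)
  refine (addOK x y).mem_initialCore
    (B.add_mem (initialCore_subset _ hx) (initialCore_subset _ hy)) ?_
  rintro _ ((⟨a, ha, rfl⟩ | ⟨b, hb, rfl⟩) | (⟨a, ha, rfl⟩ | ⟨b, hb, rfl⟩))
  · exact hl a ha.2
  · exact hr b hb.2
  · exact hl a ha.2
  · exact hr b hb.2

theorem neg_mem_initialCore {x : Surreal.{u}} (hx : x ∈ initialCore (B : Set Surreal.{u})) :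
    -x ∈ initialCore (B : Set Surreal.{u}) := by
  intro z hz
  have h := hx (-z) (neg_neg' x ▸ hz.neg)
  exact neg_neg' z ▸ B.neg_mem h

theorem mul_mem_initialCore {x y : Surreal.{u}} (hx : x ∈ initialCore (B : Set Surreal.{u}))
    (hy : y ∈ initialCore (B : Set Surreal.{u})) :
    x * y ∈ initialCore (B : Set Surreal.{u}) := by
  induction x using strictlySimpler_wf.induction generalizing y with | _ x ihx =>
  induction y using strictlySimpler_wf.induction with | _ y ihy =>
  have key (a b : Surreal.{u}) (ha : StrictlySimpler a x) (hb : StrictlySimpler b y) :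
      mulOpt x y a b ∈ initialCore (B : Set Surreal.{u}) := by
    have ha' := isInitial_initialCore _ x hx a ha.simpler
    have hb' := isInitial_initialCore _ y hy b hb.simpler
    rw [mulOpt, sub_eq_add_neg]
    exact add_mem_initialCore B (add_mem_initialCore B (ihx a ha ha' hy) (ihy b hb hb'))
      (neg_mem_initialCore B (ihx a ha ha' hb'))
  refine (mulOK x y).mem_initialCore
    (B.mul_mem (initialCore_subset _ hx) (initialCore_subset _ hy)) ?_
  rintro _ ((⟨a, ha, b, hb, rfl⟩ | ⟨a, ha, b, hb, rfl⟩) |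
    (⟨a, ha, b, hb, rfl⟩ | ⟨a, ha, b, hb, rfl⟩))
  all_goals exact key a b ha.2 hb.2

end Subring

/-- The subring generated by an initial class is initial. -/
theorem IsInitial.closure {A : Set Surreal.{u}} (hA : IsInitial A) :
    IsInitial (Subring.closure A : Set Surreal.{u}) := by
  set B := Subring.closure A
  have hB : (B : Set Surreal.{u}) ⊆ initialCore (B : Set Surreal.{u}) := by
    intro x hx
    induction hx using Subring.closure_induction with
    | mem x hx => exact hA.subset_initialCore Subring.subset_closure hx
    | zero => exact fun z hz => hz.antisymm (zero_simpler z) ▸ B.zero_mem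
    | one =>
      intro z hz
      by_cases h : z = 1
      · exact h ▸ B.one_mem
      · exact eq_zero_of_strictlySimpler_one (hz.strictlySimpler h) ▸ B.zero_mem
    | add x y _ _ hx hy => exact add_mem_initialCore B hx hy
    | neg x _ hx => exact neg_mem_initialCore B hx
    | mul x y _ _ hx hy => exact mul_mem_initialCore B hx hy
  exact fun x hx y hy => hB hx y hy

/-- Adding `{L | R}` to an initial class that contains `L` and `R` gives an initial class. -/
theorem IsInitial.union_singleton {A L R : Set Surreal.{u}} {c : Surreal.{u}} (hA : IsInitial A)
    (hL : L ⊆ A) (hR : R ⊆ A) (hc : IsCut L R c) : IsInitial (A ∪ {c}) := by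
  rintro x (hx | rfl) y hy
  · exact .inl (hA x hx y hy)
  · exact hc.mem_initialCore (.inr rfl)
      ((Set.union_subset hL hR).trans (hA.subset_initialCore Set.subset_union_left)) y hy

end Surreal

theorem mainTheorem11 (K : Subring Surreal.{u}) (hK : Surreal.IsInitial (K : Set Surreal.{u}))
    (L R : Set Surreal.{u}) [Small.{u} L] [Small.{u} R]
    (hL : L ⊆ (K : Set Surreal.{u})) (hR : R ⊆ (K : Set Surreal.{u}))
    (hLR : ∀ l ∈ L, ∀ r ∈ R, l < r) :
    Surreal.IsInitial
      ((Algebra.adjoin K {Surreal.cut L R}).toSubring : Set Surreal.{u}) := by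
  have h := (hK.union_singleton hL hR (Surreal.isCut_cut L R hLR)).closure
  rw [Algebra.adjoin_eq_ring_closure]
  have hr : Set.range (algebraMap K Surreal.{u}) = (K : Set Surreal.{u}) := Subtype.range_coe
  rw [hr]
  exact h
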